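/- Throughout, a continuous density on $\mathbb R^N$ is a continuous function $g\ge 0$ with $\int g=1$; sample means and sample variances are $\overline x=\frac1m\sum_i x_i$ and $\frac1{m-1}\sum_i(x_i-\overline x)^2$; and $\mathbf P(T>u\mid H_i)$ is the probability of $\{T>u\}$ when the data vector has density $g_i$. In each of the following three cases let $\mathcal G$ be the class of continuous densities that satisfy the stated conditions (a), (b), and let $K$ be the stated functional. Then $0<K(g)<\infty$ for every $g\in\mathcal G$, and for all $g_0,g_1\in\mathcal G$ $$\frac{\mathbf P(T>u\mid H_1)}{\mathbf P(T>u\mid H_0)}\longrightarrow\frac{K(g_1)}{K(g_0)}\qquad\text{as }u\to\infty .$$ (i) One-sample $t$-statistic. Let $n\ge2$, $T=\sqrt n\,\overline X/S$ for $X\in\mathbb R^n$, where $\overline X$ and $S^2$ are the sample mean and variance, and let $I=(1/\sqrt n,\dots,1/\sqrt n)$. Conditions: (a) $g(xI)>0$ for some $x\ge0$; (b) for some $\varepsilon>0$, $$\int_0^\infty r^{n-1}\sup_{\xi\perp I,\ \|\xi\|<\varepsilon}g\bigl(r(I+\xi)\bigr)\,dr<\infty .$$ Functional: $$K(g)=\frac{2\pi^{n/2}}{\Gamma(n/2)}\int_0^\infty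 r^{n-1}g(rI)\,dr .$$ (ii) Two-sample $t$-statistic. Let $n_1,n_2\ge2$, $n=n_1+n_2$, $\alpha,\beta>0$, and $$T=\frac{\overline X_1-\overline X_2}{\sqrt{\alpha S_1^2+\beta S_2^2}},$$ where $\overline X_1,S_1^2$ and $\overline X_2,S_2^2$ are the sample means and variances of the first $n_1$ and of the last $n_2$ coordinates of $X\in\mathbb R^n$. Let $I_1=(1/\sqrt{n_1},\dots,1/\sqrt{n_1},0,\dots,0)$ and $I_2=(0,\dots,0,1/\sqrt{n_2},\dots,1/\sqrt{n_2})$ be the normalized indicator vectors of the two groups of coordinates, $\omega_0=\arccos\sqrt{n_2/n}$ and $v(\omega)=\cos(\omega-\omega_0)I_1+\sin(\omega-\omega_0)I_2$. Conditions: (a) $g(r\,v(\omega))>0$ for some $r\ge0$ and $\omega\in[-\pi/2,\pi/2]$; (b) for some $\varepsilon>0$, $$\int_{-\pi/2}^{\pi/2}\cos(\omega)^{n-2}\int_0^\infty r^{n-1}\sup_{\xi\perp I_1,I_2,\ \|\xi\|<\varepsilon}g\bigl(r(v(\omega)+\xi)\bigr)\,dr\,d\omega<\infty .$$ Functional: $$K(g)=C\int_{-\pi/2}^{\pi/2}\cos(\omega)^{n-2}\int_0^\infty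 r^{n-1}g\bigl(r\,v(\omega)\bigr)\,dr\,d\omega,$$ $$C=\frac{2\pi^{\frac{n-1}2}\bigl(\frac{n_1-1}\alpha\bigr)^{\frac{n_1-1}2}\bigl(\frac{n_2-1}\beta\bigr)^{\frac{n_2-1}2}\bigl(\frac1{n_1}+\frac1{n_2}\bigr)^{\frac{n-2}2}}{\Gamma\bigl(\frac{n-1}2\bigr)(n-2)^{\frac{n-2}2}} .$$ In particular this applies to the Student (pooled-variance) two-sample $t$-statistic, with $\alpha=\frac{n_1-1}{n-2}\bigl(\frac1{n_1}+\frac1{n_2}\bigr)$ and $\beta=\frac{n_2-1}{n-2}\bigl(\frac1{n_1}+\frac1{n_2}\bigr)$, and to the Welch statistic, with $\alpha=1/n_1$ and $\beta=1/n_2$. (iii) $F$-statistic. Let $n_1,n_2\ge2$, $n=n_1+n_2$, $T=S_1^2/S_2^2$, where $S_1^2$ and $S_2^2$ are the sample variances of $X\in\mathbb R^{n_1}$ and $Y\in\mathbb R^{n_2}$, and let $g(x,y)$ denote a joint density of $(X,Y)$. Let $s_1(x)$ be the sample standard deviation of $x\in\mathbb R^{n_1}$ and $I=(1/\sqrt{n_2},\dots,1/\sqrt{n_2})\in\mathbb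 R^{n_2}$. Conditions: (a) $s_1(x)\,g(x,rI)>0$ for some $x\in\mathbb R^{n_1}$ and $r\in\mathbb R$; (b) for some $\varepsilon>0$, $$\int_{\mathbb R^{n_1}}s_1(x)^{n_2-1}\int_{-\infty}^\infty\sup_{\xi\perp I,\ \|\xi\|<\varepsilon}g\bigl(x,rI+s_1(x)\xi\bigr)\,dr\,dx<\infty .$$ Functional: $$K(g)=\frac{\Gamma\bigl(\frac{n_1-1}2\bigr)\bigl(\pi(n_1-1)\bigr)^{\frac{n_2-1}2}}{\Gamma\bigl(\frac{n-2}2\bigr)}\int_{\mathbb R^{n_1}}s_1(x)^{n_2-1}\int_{-\infty}^\infty g(x,rI)\,dr\,dx .$$ -/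

import Mathlib

open MeasureTheory Filter Topology
open scoped ENNReal

noncomputable section

namespace TestTails

/-- `ℝ^ι` with its Euclidean norm and Lebesgue measure. -/
abbrev Euc (ι : Type) [Fintype ι] : Type := EuclideanSpace ℝ ι

/-! ### Sample moments -/

/-- The sample mean. -/
def sampleMean {m : ℕ} (x : Fin m → ℝ) : ℝ :=
  (∑ i, x i) / (m : ℝ)

/-- The (unbiased) sample variance. -/
def sampleVar {m : ℕ} (x : Fin m → ℝ) : ℝ :=
  (∑ i, (x i - sampleMean x) ^ 2) / ((m : ℝ) - 1)

/-- The sample standard deviation. -/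
def sampleSD {m : ℕ} (x : Fin m → ℝ) : ℝ :=
  Real.sqrt (sampleVar x)

/-- The first sample of a vector indexed by `Fin n₁ ⊕ Fin n₂`. -/
def fstSample {n₁ n₂ : ℕ} (x : Euc (Fin n₁ ⊕ Fin n₂)) : Fin n₁ → ℝ :=
  fun i => x (Sum.inl i)

/-- The second sample of a vector indexed by `Fin n₁ ⊕ Fin n₂`. -/
def sndSample {n₁ n₂ : ℕ} (x : Euc (Fin n₁ ⊕ Fin n₂)) : Fin n₂ → ℝ :=
  fun j => x (Sum.inr j)

/-! ### The test statistics -/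

/-- The one-sample `t`-statistic `√n · mean / S`. -/
def oneSampleT (n : ℕ) (x : Euc (Fin n)) : ℝ :=
  Real.sqrt n * (sampleMean x / sampleSD x)

/-- The generalized two-sample `t`-statistic with weights `α`, `β`. -/
def twoSampleT (n₁ n₂ : ℕ) (α β : ℝ) (x : Euc (Fin n₁ ⊕ Fin n₂)) : ℝ :=
  (sampleMean (fstSample x) - sampleMean (sndSample x)) /
    Real.sqrt (α * sampleVar (fstSample x) + β * sampleVar (sndSample x))

/-- The Student two-sample `t`-statistic, with the pooled variance. -/
def studentTwoSampleT (n₁ n₂ : ℕ) (x : Euc (Fin n₁ ⊕ Fin n₂)) : ℝ :=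
  (sampleMean (fstSample x) - sampleMean (sndSample x)) /
    Real.sqrt
      ((((n₁ : ℝ) - 1) * sampleVar (fstSample x) + ((n₂ : ℝ) - 1) * sampleVar (sndSample x))
          / ((n₁ : ℝ) + n₂ - 2) * (1 / (n₁ : ℝ) + 1 / (n₂ : ℝ)))

/-- The Welch statistic. -/
def welchT (n₁ n₂ : ℕ) (x : Euc (Fin n₁ ⊕ Fin n₂)) : ℝ :=
  (sampleMean (fstSample x) - sampleMean (sndSample x)) /
    Real.sqrt (sampleVar (fstSample x) / n₁ + sampleVar (sndSample x) / n₂)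

/-- The `F`-statistic `S₁² / S₂²` for comparison of variances. -/
def fStat (n₁ n₂ : ℕ) (p : Euc (Fin n₁) × Euc (Fin n₂)) : ℝ :=
  sampleVar p.1 / sampleVar p.2

/-! ### Densities -/

/-- `g` is a continuous probability density on `E`. -/
structure IsContDensity {E : Type} [TopologicalSpace E] [MeasureSpace E] (g : E → ℝ) : Prop where
  continuous : Continuous g
  nonneg : ∀ x, 0 ≤ g x
  lintegral_eq_one : ∫⁻ x, ENNReal.ofReal (g x) = 1

/-- Under `P`, the random vector `X` has density `g` with respect to Lebesgue measure. -/
structure HasDensity {Ω E : Type*} [MeasurableSpace Ω] [MeasureSpace E]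
    (P : Measure Ω) (X : Ω → E) (g : E → ℝ) : Prop where
  aemeasurable : AEMeasurable X P
  map_eq : P.map X = (volume : Measure E).withDensity fun x => ENNReal.ofReal (g x)

/-! ### The one-sample `t`-statistic -/

/-- The unit vector `(1/√m, …, 1/√m)`. -/
def unitDiag (m : ℕ) : Euc (Fin m) :=
  WithLp.toLp 2 fun _ => 1 / Real.sqrt m

/-- The class of admissible densities for the one-sample `t`-statistic. -/
structure OneSampleRegular (n : ℕ) (g : Euc (Fin n) → ℝ) : Prop where
  density : IsContDensity g
  pos : ∃ x : ℝ, 0 ≤ x ∧ 0 < g (x • unitDiag n)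
  integrable : ∃ ε : ℝ, 0 < ε ∧
    ∫⁻ r in Set.Ioi (0 : ℝ), ENNReal.ofReal (r ^ (n - 1)) *
      (⨆ ξ : {ξ : Euc (Fin n) // ξ ∈ (Submodule.span ℝ {unitDiag n})ᗮ ∧ ‖ξ‖ < ε},
        ENNReal.ofReal (g (r • (unitDiag n + ξ.1)))) < ⊤

/-- The functional `K` for the one-sample `t`-statistic. -/
def oneSampleK (n : ℕ) (g : Euc (Fin n) → ℝ) : ℝ≥0∞ :=
  ENNReal.ofReal (2 * Real.pi ^ ((n : ℝ) / 2) / Real.Gamma ((n : ℝ) / 2)) *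
    ∫⁻ r in Set.Ioi (0 : ℝ), ENNReal.ofReal (r ^ (n - 1)) * ENNReal.ofReal (g (r • unitDiag n))

/-! ### The two-sample `t`-statistic -/

/-- The unit vector `(1/√n₁, …, 1/√n₁, 0, …, 0)`. -/
def unitFst (n₁ n₂ : ℕ) : Euc (Fin n₁ ⊕ Fin n₂) :=
  WithLp.toLp 2 (Sum.elim (fun _ => 1 / Real.sqrt n₁) (fun _ => 0))

/-- The unit vector `(0, …, 0, 1/√n₂, …, 1/√n₂)`. -/
def unitSnd (n₁ n₂ : ℕ) : Euc (Fin n₁ ⊕ Fin n₂) :=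
  WithLp.toLp 2 (Sum.elim (fun _ => 0) (fun _ => 1 / Real.sqrt n₂))

/-- The angle `ω₀ = arccos √(n₂ / n)`. -/
def omegaZero (n₁ n₂ : ℕ) : ℝ :=
  Real.arccos (Real.sqrt ((n₂ : ℝ) / ((n₁ : ℝ) + n₂)))

/-- The direction `cos (ω - ω₀) I₁ + sin (ω - ω₀) I₂`. -/
def planeDir (n₁ n₂ : ℕ) (ω : ℝ) : Euc (Fin n₁ ⊕ Fin n₂) :=
  Real.cos (ω - omegaZero n₁ n₂) • unitFst n₁ n₂ + Real.sin (ω - omegaZero n₁ n₂) • unitSnd n₁ n₂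

/-- The class of admissible densities for the two-sample `t`-statistics. -/
structure TwoSampleRegular (n₁ n₂ : ℕ) (g : Euc (Fin n₁ ⊕ Fin n₂) → ℝ) : Prop where
  density : IsContDensity g
  pos : ∃ r : ℝ, 0 ≤ r ∧ ∃ ω ∈ Set.Icc (-(Real.pi / 2)) (Real.pi / 2),
    0 < g (r • planeDir n₁ n₂ ω)
  integrable : ∃ ε : ℝ, 0 < ε ∧
    ∫⁻ ω in Set.Icc (-(Real.pi / 2)) (Real.pi / 2),
      ENNReal.ofReal (Real.cos ω ^ (n₁ + n₂ - 2)) *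
        ∫⁻ r in Set.Ioi (0 : ℝ), ENNReal.ofReal (r ^ (n₁ + n₂ - 1)) *
          (⨆ ξ : {ξ : Euc (Fin n₁ ⊕ Fin n₂) //
              ξ ∈ (Submodule.span ℝ {unitFst n₁ n₂, unitSnd n₁ n₂})ᗮ ∧ ‖ξ‖ < ε},
            ENNReal.ofReal (g (r • (planeDir n₁ n₂ ω + ξ.1)))) < ⊤

/-- The constant `C(n₁, n₂, α, β)`. -/
def twoSampleC (n₁ n₂ : ℕ) (α β : ℝ) : ℝ :=
  (2 * Real.pi ^ (((n₁ : ℝ) + n₂ - 1) / 2)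
      * (((n₁ : ℝ) - 1) / α) ^ (((n₁ : ℝ) - 1) / 2)
      * (((n₂ : ℝ) - 1) / β) ^ (((n₂ : ℝ) - 1) / 2)
      * (1 / (n₁ : ℝ) + 1 / (n₂ : ℝ)) ^ (((n₁ : ℝ) + n₂ - 2) / 2))
    / (Real.Gamma (((n₁ : ℝ) + n₂ - 1) / 2)
      * ((n₁ : ℝ) + n₂ - 2) ^ (((n₁ : ℝ) + n₂ - 2) / 2))

/-- The functional `K` for the two-sample `t`-statistic with weights `α`, `β`. -/
def twoSampleK (n₁ n₂ : ℕ) (α β : ℝ) (g : Euc (Fin n₁ ⊕ Fin n₂) → ℝ) : ℝ≥0∞ :=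
  ENNReal.ofReal (twoSampleC n₁ n₂ α β) *
    ∫⁻ ω in Set.Icc (-(Real.pi / 2)) (Real.pi / 2),
      ENNReal.ofReal (Real.cos ω ^ (n₁ + n₂ - 2)) *
        ∫⁻ r in Set.Ioi (0 : ℝ), ENNReal.ofReal (r ^ (n₁ + n₂ - 1)) *
          ENNReal.ofReal (g (r • planeDir n₁ n₂ ω))

/-! ### The `F`-statistic -/

/-- The class of admissible densities for the `F`-statistic. -/
structure FRegular (n₁ n₂ : ℕ) (g : Euc (Fin n₁) × Euc (Fin n₂) → ℝ) : Prop where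
  density : IsContDensity g
  pos : ∃ (x : Euc (Fin n₁)) (r : ℝ), 0 < sampleSD x * g (x, r • unitDiag n₂)
  integrable : ∃ ε : ℝ, 0 < ε ∧
    ∫⁻ x : Euc (Fin n₁), ENNReal.ofReal (sampleSD x ^ (n₂ - 1)) *
      ∫⁻ r : ℝ,
        (⨆ ξ : {ξ : Euc (Fin n₂) // ξ ∈ (Submodule.span ℝ {unitDiag n₂})ᗮ ∧ ‖ξ‖ < ε},
          ENNReal.ofReal (g (x, r • unitDiag n₂ + sampleSD x • ξ.1))) < ⊤

/-- The functional `K` for the `F`-statistic. -/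
def fK (n₁ n₂ : ℕ) (g : Euc (Fin n₁) × Euc (Fin n₂) → ℝ) : ℝ≥0∞ :=
  ENNReal.ofReal
      (Real.Gamma (((n₁ : ℝ) - 1) / 2) * (Real.pi * ((n₁ : ℝ) - 1)) ^ (((n₂ : ℝ) - 1) / 2)
        / Real.Gamma (((n₁ : ℝ) + n₂ - 2) / 2)) *
    ∫⁻ x : Euc (Fin n₁), ENNReal.ofReal (sampleSD x ^ (n₂ - 1)) *
      ∫⁻ r : ℝ, ENNReal.ofReal (g (x, r • unitDiag n₂))

/-! ### Comparison of tails -/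

universe v

/-- On the class `𝒢` the functional `K` takes values in `(0, ∞)`, and whenever the random
vector `X` has density `g₀ ∈ 𝒢` under `P₀` (the null hypothesis) and density `g₁ ∈ 𝒢` under `P₁`
(the alternative), then `P₁(T > u) / P₀(T > u) → K g₁ / K g₀` as `u → ∞`. -/
def TailComparison {E : Type} [MeasureSpace E] (T : E → ℝ) (𝒢 : (E → ℝ) → Prop)
    (K : (E → ℝ) → ℝ≥0∞) : Prop :=
  (∀ g, 𝒢 g → 0 < K g ∧ K g < ⊤) ∧
  ∀ g₀ g₁ : E → ℝ, 𝒢 g₀ → 𝒢 g₁ →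
    ∀ (Ω : Type v) [MeasurableSpace Ω] (P₀ P₁ : Measure Ω) (X : Ω → E),
      HasDensity P₀ X g₀ → HasDensity P₁ X g₁ →
        Tendsto (fun u : ℝ => P₁.real {ω | u < T (X ω)} / P₀.real {ω | u < T (X ω)})
          atTop (𝓝 ((K g₁).toReal / (K g₀).toReal))

end TestTails

end

/-! For large `u` the event `{T > u}` is a thin tube around the subspace on which the denominator of
`T` vanishes. In suitable linear coordinates `x = L (a, η)`, with `a` along that subspace and `η`
transverse, the statistic is an increasing function (for large values) of `s a / Q η`, where `Q` is
continuous, positively homogeneous of degree one and bounded below by a multiple of the norm. The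
event then says that `s a > 0` and that `η` lies in `D = {0 < Q < 1}` dilated by `δ * s a`, with `δ
→ 0` as `u → ∞`.

Put `η = (δ * s a) • ζ` with `ζ ∈ D`, and let `d` be the transverse dimension. The Jacobian is `δ ^
d * s a ^ d`, so the probability is a constant times `δ ^ d` times the integral of `s a ^ d * g (L
(a, (δ * s a) • ζ))`. Condition (b) dominates this integrand, and continuity of `g` gives the limit
`ν D * ∫ s ^ d * g (L (a, 0))`. In the quotient for two densities the Haar constant, `δ ^ d` and `ν
D` cancel. The prefactor of `K` cancels too, so only its being positive and finite matters.

`lintegral_tube` is the change of variables, `tendsto_tubeMass` the limit, and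
`tailComparison_of_ratio` the form applied to each statistic. What remains for each is to find `L`,
`s`, `Q` and to identify the integral over `a` with the one in `K`. -/

noncomputable section

namespace TestTails

/-! ### Thin tubes around a subspace -/

section Tube

variable {A E F : Type} [NormedAddCommGroup A] [NormedSpace ℝ A]
  [MeasureSpace A] [BorelSpace A]
  [NormedAddCommGroup F] [NormedSpace ℝ F] [FiniteDimensional ℝ F]
  [MeasurableSpace F] [BorelSpace F]
  [NormedAddCommGroup E] [NormedSpace ℝ E] [MeasureSpace E] [BorelSpace E]

/-- The rescaled mass which `G` gives to the tube `{L (a, η) | η ∈ (δ * s a) • D}`. -/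
def tubeMass (L : (A × F) ≃L[ℝ] E) (s : A → ℝ) (ν : Measure F) (D : Set F) (G : E → ℝ≥0∞)
    (δ : ℝ) : ℝ≥0∞ :=
  ∫⁻ p, ENNReal.ofReal (s p.1 ^ Module.finrank ℝ F) * G (L (p.1, (δ * s p.1) • p.2))
    ∂((volume : Measure A).restrict {a | 0 < s a}).prod (ν.restrict D)

theorem lintegral_indicator_inv_smul (ν : Measure F) [ν.IsAddHaarMeasure] {D : Set F}
    (hD : MeasurableSet D) {h : F → ℝ≥0∞} (hh : Measurable h) {t : ℝ} (ht : 0 < t) :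
    ∫⁻ η, {η | t⁻¹ • η ∈ D}.indicator h η ∂ν
      = ENNReal.ofReal (t ^ Module.finrank ℝ F) * ∫⁻ ζ in D, h (t • ζ) ∂ν := by
  have hD' : MeasurableSet {η : F | t⁻¹ • η ∈ D} := measurable_const_smul t⁻¹ hD
  have h1 := Measure.map_addHaar_smul ν ht.ne'
  have h2 : ∫⁻ ζ in D, h (t • ζ) ∂ν
      = ∫⁻ η, {η | t⁻¹ • η ∈ D}.indicator h η ∂(ν.map (t • ·)) := by
    rw [lintegral_map (hh.indicator hD') (measurable_const_smul t), ← lintegral_indicator hD]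
    refine lintegral_congr fun ζ => ?_
    classical
    simp only [Set.indicator_apply]
    exact if_congr (by simp [inv_smul_smul₀ ht.ne']) rfl rfl
  have hpos : 0 < t ^ Module.finrank ℝ F := pow_pos ht _
  rw [h2, h1, lintegral_smul_measure, abs_of_pos (inv_pos.2 hpos), smul_eq_mul, ← mul_assoc,
    ← ENNReal.ofReal_mul hpos.le, mul_inv_cancel₀ hpos.ne', ENNReal.ofReal_one, one_mul]

/-- By Fubini the fibre over `a` is `D` dilated by `δ * s a`. Rescaling it to `D` costs `(δ * s a) ^
d`; the factor `δ ^ d` does not depend on `a` and comes out, while `s a ^ d` stays as the weight. -/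
theorem lintegral_tube (L : (A × F) ≃L[ℝ] E) {s : A → ℝ} (hs : Measurable s) (ν : Measure F)
    [ν.IsAddHaarMeasure] {D : Set F} (hD : MeasurableSet D) {G : E → ℝ≥0∞} (hG : Measurable G)
    {δ : ℝ} (hδ : 0 < δ) {B : Set E} (hBm : MeasurableSet B)
    (hB : ∀ a η, L (a, η) ∈ B ↔ 0 < s a ∧ (δ * s a)⁻¹ • η ∈ D) :
    ∫⁻ x in B, G x ∂(((volume : Measure A).prod ν).map L)
      = ENNReal.ofReal (δ ^ Module.finrank ℝ F) * tubeMass L s ν D G δ := by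
  have hL : Measurable L := L.continuous.measurable
  have hS : MeasurableSet {a | 0 < s a} := measurableSet_lt measurable_const hs
  have hmeas : Measurable fun p : A × F => B.indicator G (L p) := (hG.indicator hBm).comp hL
  rw [← lintegral_indicator hBm, lintegral_map (hG.indicator hBm) hL,
    lintegral_prod _ hmeas.aemeasurable, tubeMass, lintegral_prod, ← lintegral_const_mul,
    ← lintegral_indicator hS]
  · refine lintegral_congr fun a => ?_
    by_cases ha : 0 < s a
    · rw [Set.indicator_of_mem (by exact ha)]
      have ht := mul_pos hδ ha
      have := lintegral_indicator_inv_smul ν hD (h := fun η => G (L (a, η)))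
        (hG.comp (hL.comp measurable_prodMk_left)) ht
      rw [mul_pow, ENNReal.ofReal_mul (by positivity), mul_assoc, ← lintegral_const_mul] at this
      · rw [← this]
        refine lintegral_congr fun η => ?_
        classical
        simp only [Set.indicator_apply]
        exact if_congr (by simp [hB, ha]) rfl rfl
      · exact hG.comp (hL.comp (measurable_prodMk_left.comp (measurable_const_smul _)))
    · rw [Set.indicator_of_notMem (by exact ha)]
      refine (lintegral_congr fun η => ?_).trans lintegral_zero
      exact Set.indicator_of_notMem (by rw [hB]; tauto) _
  · refine Measurable.lintegral_prod_right' (f := fun p : A × F =>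
      ENNReal.ofReal (s p.1 ^ Module.finrank ℝ F) * G (L (p.1, (δ * s p.1) • p.2))) ?_
    fun_prop
  · refine Measurable.aemeasurable ?_
    fun_prop

/-- Dominated convergence. Since `D` is bounded, `δ • ζ` lies in the `ε`-ball for all `ζ ∈ D` once
`δ` is small, so the supremum in `hfin` dominates; it is constant in `ζ`, and `ν D` is finite. -/
theorem tendsto_tubeMass [SFinite (volume : Measure A)] (L : (A × F) ≃L[ℝ] E) {s : A → ℝ}
    (hs : Measurable s) (ν : Measure F) [ν.IsAddHaarMeasure] {D : Set F} (hD : MeasurableSet D)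
    {R : ℝ} (hR : ∀ ζ ∈ D, ‖ζ‖ ≤ R)
    {G : E → ℝ≥0∞} (hG : Continuous G) {ε : ℝ} (hε : 0 < ε)
    (hfin : ∫⁻ a in {a | 0 < s a}, ENNReal.ofReal (s a ^ Module.finrank ℝ F) *
      (⨆ ξ : {ξ : F // ‖ξ‖ < ε}, G (L (a, s a • ξ.1))) ≠ ⊤) :
    Tendsto (tubeMass L s ν D G) (𝓝[>] 0)
      (𝓝 (ν D * ∫⁻ a in {a | 0 < s a},
        ENNReal.ofReal (s a ^ Module.finrank ℝ F) * G (L (a, 0)))) := by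
  have hGm := hG.measurable
  have hL : Measurable L := L.continuous.measurable
  have hνD : ν D ≠ ⊤ :=
    ((measure_mono fun ζ hζ => mem_closedBall_zero_iff.2 (hR ζ hζ)).trans_lt
      (measure_closedBall_lt_top (x := (0 : F)) (r := R))).ne
  have key : ν D * ∫⁻ a in {a | 0 < s a}, ENNReal.ofReal (s a ^ Module.finrank ℝ F) * G (L (a, 0))
      = ∫⁻ p : A × F, ENNReal.ofReal (s p.1 ^ Module.finrank ℝ F) * G (L (p.1, 0))
        ∂((volume : Measure A).restrict {a | 0 < s a}).prod (ν.restrict D) := by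
    rw [lintegral_prod _ (Measurable.aemeasurable (by fun_prop))]
    simp only [lintegral_const, Measure.restrict_apply_univ]
    rw [lintegral_mul_const _ (by fun_prop), mul_comm]
  rw [key]
  refine tendsto_lintegral_filter_of_dominated_convergence
    (fun p => ENNReal.ofReal (s p.1 ^ Module.finrank ℝ F) *
      (⨆ ξ : {ξ : F // ‖ξ‖ < ε}, G (L (p.1, s p.1 • ξ.1)))) ?_ ?_ ?_ ?_
  · exact Eventually.of_forall fun δ => by fun_prop
  · have hsm : ∀ᶠ δ : ℝ in 𝓝[>] 0, δ * R < ε := by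
      have : Tendsto (fun δ : ℝ => δ * R) (𝓝[>] 0) (𝓝 (0 * R)) :=
        ((continuous_mul_const R).tendsto 0).mono_left nhdsWithin_le_nhds
      rw [zero_mul] at this
      exact this.eventually_lt_const hε
    filter_upwards [hsm, self_mem_nhdsWithin] with δ h1 (h2 : 0 < δ)
    rw [Measure.prod_restrict]
    refine (ae_restrict_iff' ((measurableSet_lt measurable_const hs).prod hD)).2
      (Eventually.of_forall fun p hp => ?_)
    have hlt : ‖δ • p.2‖ < ε := by
      rw [norm_smul, Real.norm_of_nonneg h2.le]
      exact (mul_le_mul_of_nonneg_left (hR _ hp.2) h2.le).trans_lt h1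
    gcongr
    refine le_trans (le_of_eq ?_)
      (le_iSup (fun ξ : {ξ : F // ‖ξ‖ < ε} => G (L (p.1, s p.1 • ξ.1))) ⟨δ • p.2, hlt⟩)
    simp only [smul_smul, mul_comm]
  -- This half of Tonelli needs no measurability, which is not assumed of the supremum.
  · refine ((lintegral_prod_le _).trans_lt ?_).ne
    simp only [lintegral_const, Measure.restrict_apply_univ]
    rw [lintegral_mul_const' _ _ hνD]
    exact ENNReal.mul_lt_top hfin.lt_top hνD.lt_top
  · refine Eventually.of_forall fun p => ENNReal.Tendsto.const_mul ?_ (Or.inr ENNReal.ofReal_ne_top)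
    have : Continuous fun δ : ℝ => G (L (p.1, (δ * s p.1) • p.2)) := by fun_prop
    have h0 := this.tendsto 0
    simp only [zero_mul, zero_smul] at h0
    exact h0.mono_left nhdsWithin_le_nhds

/-- If, in linear coordinates `x = L (a, η)`, the event `{u < T}` is the tube
`{0 < s a, η ∈ (δ u * s a) • D}` around the subspace `η = 0`, then the tails of `T` under two
densities compare as the integrals of the densities along this subspace, with weight `s ^ d`. -/
theorem tailComparison_of_tube [FiniteDimensional ℝ A] [(volume : Measure A).IsAddHaarMeasure]
    [FiniteDimensional ℝ E] [(volume : Measure E).IsAddHaarMeasure]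
    (L : (A × F) ≃L[ℝ] E) {s : A → ℝ} (hs : Continuous s)
    {D : Set F} (hDo : IsOpen D) (hDn : D.Nonempty) {R : ℝ} (hR : ∀ ζ ∈ D, ‖ζ‖ ≤ R)
    {T : E → ℝ} (hT : Measurable T) {δ : ℝ → ℝ} (hδ : Tendsto δ atTop (𝓝[>] 0))
    (htube : ∀ᶠ u in atTop, ∀ a η, u < T (L (a, η)) ↔ 0 < s a ∧ (δ u * s a)⁻¹ • η ∈ D)
    {𝒢 : (E → ℝ) → Prop} {K : (E → ℝ) → ℝ≥0∞} {C : ℝ≥0∞} (hC0 : C ≠ 0) (hCt : C ≠ ⊤)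
    (hdens : ∀ g, 𝒢 g → IsContDensity g)
    (hpos : ∀ g, 𝒢 g → ∃ a, 0 < s a ∧ 0 < g (L (a, 0)))
    (hint : ∀ g, 𝒢 g → ∃ ε : ℝ, 0 < ε ∧
      ∫⁻ a in {a | 0 < s a}, ENNReal.ofReal (s a ^ Module.finrank ℝ F) *
        (⨆ ξ : {ξ : F // ‖ξ‖ < ε}, ENNReal.ofReal (g (L (a, s a • ξ.1)))) ≠ ⊤)
    (hK : ∀ g, 𝒢 g → K g = C * ∫⁻ a in {a | 0 < s a},
      ENNReal.ofReal (s a ^ Module.finrank ℝ F) * ENNReal.ofReal (g (L (a, 0)))) :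
    TailComparison T 𝒢 K := by
  set J : (E → ℝ) → ℝ≥0∞ := fun g => ∫⁻ a in {a | 0 < s a},
    ENNReal.ofReal (s a ^ Module.finrank ℝ F) * ENNReal.ofReal (g (L (a, 0))) with hJ
  have hS : MeasurableSet {a | 0 < s a} := measurableSet_lt measurable_const hs.measurable
  have hJt : ∀ g, 𝒢 g → J g ≠ ⊤ := by
    intro g hg
    obtain ⟨ε, hε, h⟩ := hint g hg
    refine ne_top_of_le_ne_top h (lintegral_mono fun a => ?_)
    gcongr
    refine le_trans (le_of_eq ?_)
      (le_iSup (fun ξ : {ξ : F // ‖ξ‖ < ε} => ENNReal.ofReal (g (L (a, s a • ξ.1))))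
        ⟨0, by simpa using hε⟩)
    simp
  have hJ0 : ∀ g, 𝒢 g → J g ≠ 0 := by
    intro g hg
    obtain ⟨a, ha, hga⟩ := hpos g hg
    have hgc := (hdens g hg).continuous
    have hgL : Continuous fun a => g (L (a, 0)) := by fun_prop
    rw [hJ]
    simp only
    rw [← lintegral_indicator hS]
    have hm : Measurable ({a | 0 < s a}.indicator fun a =>
        ENNReal.ofReal (s a ^ Module.finrank ℝ F) * ENNReal.ofReal (g (L (a, 0)))) :=
      Measurable.indicator (by fun_prop) hS
    refine (lintegral_pos_iff_support hm).2 ?_ |>.ne'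
    -- A nonempty open set has positive Haar measure, and the integrand is positive on this one.
    refine ((isOpen_lt continuous_const hs).inter (isOpen_lt continuous_const hgL)).measure_pos
      volume ⟨a, ha, hga⟩ |>.trans_le (measure_mono ?_)
    rintro b ⟨hb, hgb⟩
    simp only [Set.mem_ofPred_eq] at hb hgb
    simp [hb, pow_pos hb, hgb]
  refine ⟨fun g hg => ?_, ?_⟩
  · rw [hK g hg]
    exact ⟨ENNReal.mul_pos hC0 (hJ0 g hg), ENNReal.mul_lt_top hCt.lt_top (hJt g hg).lt_top⟩
  intro g₀ g₁ h₀ h₁ Ω _ P₀ P₁ X hX₀ hX₁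
  let ν : Measure F := Measure.addHaar
  have hνD : ν D ≠ ⊤ :=
    ((measure_mono fun ζ hζ => mem_closedBall_zero_iff.2 (hR ζ hζ)).trans_lt
      (measure_closedBall_lt_top (x := (0 : F)) (r := R))).ne
  have hνD0 : ν D ≠ 0 := (hDo.measure_pos ν hDn).ne'
  -- The pushforward is again a Haar measure, so it is a multiple of `volume`; the determinant of
  -- `L` is never needed because `c` cancels in the quotient.
  set M : Measure E := ((volume : Measure A).prod ν).map L with hM
  have : M.IsAddHaarMeasure := ContinuousLinearEquiv.isAddHaarMeasure_map L _
  set c : NNReal := (volume : Measure E).addHaarScalarFactor M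
  have hvol : (volume : Measure E) = c • M := Measure.isAddLeftInvariant_eq_smul _ _
  have hc : c ≠ 0 := (Measure.addHaarScalarFactor_pos_of_isAddHaarMeasure _ _).ne'
  have hmass : ∀ g, 𝒢 g → ∀ P : Measure Ω, HasDensity P X g → ∀ᶠ u in atTop,
      P.real {ω | u < T (X ω)} = (c * δ u ^ Module.finrank ℝ F) *
        (tubeMass L s ν D (fun x => ENNReal.ofReal (g x)) (δ u)).toReal := by
    intro g hg P hP
    filter_upwards [htube, hδ self_mem_nhdsWithin] with u hu (hδu : 0 < δ u)
    have hB : MeasurableSet {x | u < T x} := measurableSet_lt measurable_const hT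
    have h1 : P {ω | u < T (X ω)} = P.map X {x | u < T x} :=
      (Measure.map_apply_of_aemeasurable hP.aemeasurable hB).symm
    have hgm : Measurable fun x => ENNReal.ofReal (g x) :=
      (hdens g hg).continuous.measurable.ennreal_ofReal
    rw [Measure.real, h1, hP.map_eq, withDensity_apply _ hB, hvol, Measure.restrict_smul,
      lintegral_smul_measure, lintegral_tube L hs.measurable ν hDo.measurableSet hgm hδu hB hu]
    rw [ENNReal.smul_def, smul_eq_mul, ENNReal.toReal_mul, ENNReal.toReal_mul,
      ENNReal.toReal_ofReal (by positivity), ENNReal.coe_toReal, mul_assoc]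
  have hlim : ∀ g, 𝒢 g → Tendsto
      (fun u => (tubeMass L s ν D (fun x => ENNReal.ofReal (g x)) (δ u)).toReal) atTop
      (𝓝 (ν D * J g).toReal) := by
    intro g hg
    obtain ⟨ε, hε, h⟩ := hint g hg
    refine (ENNReal.tendsto_toReal (ENNReal.mul_ne_top hνD (hJt g hg))).comp ?_
    exact (tendsto_tubeMass L hs.measurable ν hDo.measurableSet hR
      (ENNReal.continuous_ofReal.comp (hdens g hg).continuous) hε h).comp hδ
  have hr0 : (J g₀).toReal ≠ 0 := ENNReal.toReal_ne_zero.2 ⟨hJ0 _ h₀, hJt _ h₀⟩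
  have hν0 : (ν D).toReal ≠ 0 := ENNReal.toReal_ne_zero.2 ⟨hνD0, hνD⟩
  have hCr : C.toReal ≠ 0 := ENNReal.toReal_ne_zero.2 ⟨hC0, hCt⟩
  have hdiv := (hlim g₁ h₁).div (hlim g₀ h₀) (by
    rw [ENNReal.toReal_mul]; exact mul_ne_zero hν0 hr0)
  have heq : (K g₁).toReal / (K g₀).toReal = (ν D * J g₁).toReal / (ν D * J g₀).toReal := by
    rw [hK _ h₁, hK _ h₀]
    simp only [ENNReal.toReal_mul]
    rw [mul_div_mul_left _ _ hCr, mul_div_mul_left _ _ hν0]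
  rw [heq]
  refine hdiv.congr' ?_
  filter_upwards [hmass g₀ h₀ P₀ hX₀, hmass g₁ h₁ P₁ hX₁, hδ self_mem_nhdsWithin]
    with u e0 e1 (hu : 0 < δ u)
  rw [e0, e1, mul_div_mul_left]
  · rfl
  · exact mul_ne_zero (by exact_mod_cast hc) (pow_ne_zero _ hu.ne')

/-- A statistic whose tail events are those of the ratio `s a / Q η`, with `Q` positively
homogeneous and nondegenerate. -/
theorem tailComparison_of_ratio [FiniteDimensional ℝ A] [(volume : Measure A).IsAddHaarMeasure]
    [FiniteDimensional ℝ E] [(volume : Measure E).IsAddHaarMeasure] [Nontrivial F]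
    (L : (A × F) ≃L[ℝ] E) {s : A → ℝ} (hs : Continuous s)
    {Q : F → ℝ} (hQc : Continuous Q) (hQh : ∀ (t : ℝ) η, 0 < t → Q (t • η) = t * Q η)
    {κ : ℝ} (hκ : 0 < κ) (hQκ : ∀ η, κ * ‖η‖ ≤ Q η)
    {T : E → ℝ} (hT : Measurable T) {ψ : ℝ → ℝ} (hψ : Tendsto ψ atTop atTop)
    (hratio : ∀ᶠ u in atTop, ∀ a η, u < T (L (a, η)) ↔ ψ u < s a / Q η)
    {𝒢 : (E → ℝ) → Prop} {K : (E → ℝ) → ℝ≥0∞} {C : ℝ≥0∞} (hC0 : C ≠ 0) (hCt : C ≠ ⊤)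
    (hdens : ∀ g, 𝒢 g → IsContDensity g)
    (hpos : ∀ g, 𝒢 g → ∃ a, 0 < s a ∧ 0 < g (L (a, 0)))
    (hint : ∀ g, 𝒢 g → ∃ ε : ℝ, 0 < ε ∧
      ∫⁻ a in {a | 0 < s a}, ENNReal.ofReal (s a ^ Module.finrank ℝ F) *
        (⨆ ξ : {ξ : F // ‖ξ‖ < ε}, ENNReal.ofReal (g (L (a, s a • ξ.1)))) ≠ ⊤)
    (hK : ∀ g, 𝒢 g → K g = C * ∫⁻ a in {a | 0 < s a},
      ENNReal.ofReal (s a ^ Module.finrank ℝ F) * ENNReal.ofReal (g (L (a, 0)))) :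
    TailComparison T 𝒢 K := by
  -- The condition `0 < Q ζ` removes the points with zero denominator: there the quotient is `0` by
  -- convention, so they are not in the event when `ψ u > 0`. The lower bound on `Q` makes `D`
  -- bounded.
  refine tailComparison_of_tube L hs (D := {ζ | 0 < Q ζ} ∩ {ζ | Q ζ < 1}) (R := κ⁻¹)
    (δ := fun u => (ψ u)⁻¹) ?_ ?_ ?_ hT ?_ ?_ hC0 hCt hdens hpos hint hK
  · exact (isOpen_lt continuous_const hQc).inter (isOpen_lt hQc continuous_const)
  · obtain ⟨ζ, hζ⟩ := exists_ne (0 : F)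
    have h1 : 0 < Q ζ := (mul_pos hκ (norm_pos_iff.2 hζ)).trans_le (hQκ ζ)
    -- Homogeneity normalizes any nonzero vector into `D`.
    have h2 : Q ((2 * Q ζ)⁻¹ • ζ) = 1 / 2 := by
      rw [hQh _ _ (by positivity)]
      field_simp
    refine ⟨(2 * Q ζ)⁻¹ • ζ, ?_, ?_⟩
    · simp only [Set.mem_ofPred_eq, h2]
      norm_num
    · simp only [Set.mem_ofPred_eq, h2]
      norm_num
  · rintro ζ ⟨-, h⟩
    have h1 : κ * ‖ζ‖ ≤ 1 := (hQκ ζ).trans (le_of_lt h)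
    rw [← mul_le_mul_iff_right₀ hκ, mul_inv_cancel₀ hκ.ne']
    exact h1
  · exact tendsto_inv_atTop_nhdsGT_zero.comp hψ
  · filter_upwards [hratio, hψ.eventually_gt_atTop 0] with u hu hpu a η
    rw [hu]
    have hQ0 : 0 ≤ Q η := (mul_nonneg hκ.le (norm_nonneg η)).trans (hQκ η)
    constructor
    · intro h
      have hq : 0 < Q η := by
        refine hQ0.lt_of_ne fun h0 => ?_
        rw [← h0, div_zero] at h
        exact h.not_gt hpu
      have hsa : ψ u * Q η < s a := (lt_div_iff₀ hq).1 h
      have hs0 : 0 < s a := (mul_pos hpu hq).trans hsa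
      have hsc : Q (((ψ u)⁻¹ * s a)⁻¹ • η) = ψ u * Q η / s a := by
        rw [hQh _ _ (by positivity)]
        field_simp
      refine ⟨hs0, ?_, ?_⟩
      · simp only [Set.mem_ofPred_eq, hsc]
        positivity
      · simp only [Set.mem_ofPred_eq, hsc]
        exact (div_lt_one hs0).2 hsa
    · rintro ⟨hs0, h1, h2⟩
      have hsc : Q (((ψ u)⁻¹ * s a)⁻¹ • η) = ψ u * Q η / s a := by
        rw [hQh _ _ (by positivity)]
        field_simp
      simp only [Set.mem_ofPred_eq, hsc] at h1 h2
      have hq : 0 < Q η := by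
        refine hQ0.lt_of_ne fun h0 => ?_
        rw [← h0] at h1
        simp at h1
      exact (lt_div_iff₀ hq).2 ((div_lt_one hs0).1 h2)

end Tube

/-! ### Sample moments in coordinates along and across the diagonal -/

theorem sampleMean_const_add {m : ℕ} (hm : m ≠ 0) (c : ℝ) {η : Fin m → ℝ} (hη : ∑ i, η i = 0) :
    sampleMean (fun i => c + η i) = c := by
  have : (m : ℝ) ≠ 0 := by exact_mod_cast hm
  simp [sampleMean, Finset.sum_add_distrib, hη]
  field_simp

theorem sampleVar_const_add {m : ℕ} (hm : m ≠ 0) (c : ℝ) {η : Fin m → ℝ} (hη : ∑ i, η i = 0) :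
    sampleVar (fun i => c + η i) = (∑ i, η i ^ 2) / ((m : ℝ) - 1) := by
  simp [sampleVar, sampleMean_const_add hm c hη]

theorem continuous_sampleMean {m : ℕ} : Continuous (sampleMean (m := m)) := by
  unfold sampleMean; fun_prop

theorem continuous_sampleVar {m : ℕ} : Continuous (sampleVar (m := m)) := by
  have := continuous_sampleMean (m := m)
  unfold sampleVar; fun_prop

theorem continuous_sampleSD {m : ℕ} : Continuous (sampleSD (m := m)) :=
  continuous_sampleVar.sqrt

theorem sampleMean_smul {m : ℕ} (t : ℝ) (x : Fin m → ℝ) :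
    sampleMean (t • x) = t * sampleMean x := by
  simp [sampleMean, ← Finset.mul_sum, mul_div_assoc]

theorem sampleVar_smul {m : ℕ} (t : ℝ) (x : Fin m → ℝ) :
    sampleVar (t • x) = t ^ 2 * sampleVar x := by
  simp [sampleVar, sampleMean_smul, ← mul_sub, mul_pow, ← Finset.mul_sum, mul_div_assoc]

theorem sampleSD_smul {m : ℕ} {t : ℝ} (ht : 0 < t) (x : Fin m → ℝ) :
    sampleSD (t • x) = t * sampleSD x := by
  rw [sampleSD, sampleVar_smul, Real.sqrt_mul (sq_nonneg t), Real.sqrt_sq ht.le, sampleSD]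

theorem sampleVar_nonneg {m : ℕ} (hm : 2 ≤ m) (x : Fin m → ℝ) : 0 ≤ sampleVar x := by
  have : (2 : ℝ) ≤ m := by exact_mod_cast hm
  exact div_nonneg (Finset.sum_nonneg fun i _ => sq_nonneg _) (by linarith)

theorem unitDiag_ne_zero {m : ℕ} (hm : m ≠ 0) : unitDiag m ≠ 0 := by
  intro h
  have h1 : (unitDiag m) ⟨0, Nat.pos_of_ne_zero hm⟩ = 0 := by rw [h]; rfl
  have h2 : (0 : ℝ) < m := by exact_mod_cast Nat.pos_of_ne_zero hm
  simp [unitDiag, h2.ne'] at h1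

theorem sum_eq_zero_of_mem_orthogonal_unitDiag {m : ℕ} (hm : m ≠ 0) {η : Euc (Fin m)}
    (hη : η ∈ (Submodule.span ℝ {unitDiag m})ᗮ) : ∑ i, η i = 0 := by
  rw [Submodule.mem_orthogonal_singleton_iff_inner_right] at hη
  have h2 : (0 : ℝ) < m := by exact_mod_cast Nat.pos_of_ne_zero hm
  simpa [unitDiag, PiLp.inner_apply, ← Finset.sum_mul, ← Finset.mul_sum, h2.ne'] using hη

/-- Coordinates along and orthogonal to a line. -/
def lineEquiv {E : Type} [NormedAddCommGroup E] [InnerProductSpace ℝ E] [FiniteDimensional ℝ E]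
    (e : E) (he : e ≠ 0) : (ℝ × (Submodule.span ℝ {e})ᗮ) ≃L[ℝ] E :=
  ((LinearEquiv.prodCongr (LinearEquiv.toSpanNonzeroSingleton ℝ E e he)
    (LinearEquiv.refl ℝ (Submodule.span ℝ {e})ᗮ)).trans
    (Submodule.prodEquivOfIsCompl _ _
      (Submodule.isCompl_orthogonal (K := Submodule.span ℝ {e})))
  ).toContinuousLinearEquiv

theorem lineEquiv_apply {E : Type} [NormedAddCommGroup E] [InnerProductSpace ℝ E]
    [FiniteDimensional ℝ E] (e : E) (he : e ≠ 0) (a : ℝ) (η : (Submodule.span ℝ {e})ᗮ) :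
    lineEquiv e he (a, η) = a • e + (η : E) := by
  simp [lineEquiv, Submodule.coe_prodEquivOfIsCompl']

theorem finrank_orthogonal_unitDiag {m : ℕ} (hm : m ≠ 0) :
    Module.finrank ℝ (Submodule.span ℝ {unitDiag m})ᗮ = m - 1 := by
  have h := (lineEquiv _ (unitDiag_ne_zero hm)).toLinearEquiv.finrank_eq
  simp at h
  omega

theorem nontrivial_orthogonal_unitDiag {m : ℕ} (hm : 2 ≤ m) :
    Nontrivial (Submodule.span ℝ {unitDiag m})ᗮ := by
  have := finrank_orthogonal_unitDiag (m := m) (by omega)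
  exact Module.nontrivial_of_finrank_pos (R := ℝ) (by omega)

theorem sampleMean_line {m : ℕ} (hm : 2 ≤ m) (a : ℝ) (η : (Submodule.span ℝ {unitDiag m})ᗮ) :
    sampleMean (a • unitDiag m + (η : Euc (Fin m))) = a / Real.sqrt m := by
  have := sampleMean_const_add (by omega) (a / Real.sqrt m)
    (sum_eq_zero_of_mem_orthogonal_unitDiag (by omega) η.2)
  rw [← this]
  congr 1
  ext i
  simp [unitDiag, div_eq_mul_inv]

theorem sampleVar_line {m : ℕ} (hm : 2 ≤ m) (a : ℝ) (η : (Submodule.span ℝ {unitDiag m})ᗮ) :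
    sampleVar (a • unitDiag m + (η : Euc (Fin m))) = sampleVar (η : Euc (Fin m)) := by
  have h := sum_eq_zero_of_mem_orthogonal_unitDiag (by omega) η.2
  have h0 := sampleVar_const_add (by omega) 0 h
  have h1 := sampleVar_const_add (by omega) (a / Real.sqrt m) h
  rw [← h0] at h1
  convert h1 using 2
  · ext i
    simp [unitDiag, div_eq_mul_inv]
  · ext i
    simp

/-- In fact an equality, since the sample mean vanishes orthogonally to the diagonal. It provides
the constant `κ` of `tailComparison_of_ratio`. -/
theorem sampleSD_line_ge {m : ℕ} (hm : 2 ≤ m) (η : (Submodule.span ℝ {unitDiag m})ᗮ) :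
    (Real.sqrt ((m : ℝ) - 1))⁻¹ * ‖η‖ ≤ sampleSD (η : Euc (Fin m)) := by
  have h := sum_eq_zero_of_mem_orthogonal_unitDiag (by omega) η.2
  have h0 := sampleVar_const_add (by omega) 0 h
  simp only [zero_add] at h0
  have h2 : (2 : ℝ) ≤ m := by exact_mod_cast hm
  refine le_of_eq ?_
  have h3 : sampleSD (η : Euc (Fin m))
      = Real.sqrt ((∑ i, (η : Euc (Fin m)) i ^ 2) / ((m : ℝ) - 1)) := by
    rw [sampleSD]; congr 1
  rw [h3, Real.sqrt_div (Finset.sum_nonneg fun i _ => sq_nonneg _), Submodule.coe_norm,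
    EuclideanSpace.norm_eq]
  simp only [Real.norm_eq_abs, sq_abs]
  rw [div_eq_inv_mul]

theorem iSup_comp_le_iSup {ι ι' : Type} {f : ι → ℝ≥0∞} {f' : ι' → ℝ≥0∞} (φ : ι → ι')
    (h : ∀ i, f i = f' (φ i)) : ⨆ i, f i ≤ ⨆ i, f' i :=
  iSup_le fun i => (h i).trans_le (le_iSup f' (φ i))

/-! ### The one-sample `t`-statistic -/

/-- With `x = a • unitDiag n + η` the statistic is exactly `a / sampleSD η`; the tube surrounds the
diagonal ray and `d = n - 1`. -/
theorem tailComparison_oneSample {n : ℕ} (hn : 2 ≤ n) :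
    TailComparison (oneSampleT n) (OneSampleRegular n) (oneSampleK n) := by
  have hn0 : n ≠ 0 := by omega
  have hnR : (2 : ℝ) ≤ n := by exact_mod_cast hn
  have := nontrivial_orthogonal_unitDiag hn
  have hd := finrank_orthogonal_unitDiag hn0
  refine tailComparison_of_ratio (lineEquiv _ (unitDiag_ne_zero hn0)) (s := fun a => a)
    continuous_id (Q := fun η => sampleSD (η : Euc (Fin n))) ?_ ?_
    (κ := (Real.sqrt ((n : ℝ) - 1))⁻¹) ?_ (sampleSD_line_ge hn) ?_ (ψ := fun u => u) tendsto_id ?_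
    (C := ENNReal.ofReal (2 * Real.pi ^ ((n : ℝ) / 2) / Real.Gamma ((n : ℝ) / 2)))
    ?_ ENNReal.ofReal_ne_top (fun g hg => hg.density) ?_ ?_ ?_
  · exact continuous_sampleSD.comp (by fun_prop)
  · intro t η ht
    exact sampleSD_smul ht _
  · exact inv_pos.2 (Real.sqrt_pos.2 (by linarith))
  · have h1 := continuous_sampleMean (m := n)
    have h2 := continuous_sampleSD (m := n)
    exact measurable_const.mul ((h1.comp (by fun_prop)).measurable.div
      (h2.comp (by fun_prop)).measurable)
  · refine Eventually.of_forall fun u a η => ?_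
    have hs : Real.sqrt n ≠ 0 := (Real.sqrt_pos.2 (by linarith)).ne'
    rw [lineEquiv_apply, oneSampleT, sampleMean_line hn, sampleSD, sampleVar_line hn, ← sampleSD,
      ← mul_div_assoc, mul_div_cancel₀ _ hs]
  · have : 0 < Real.Gamma ((n : ℝ) / 2) := Real.Gamma_pos_of_pos (by linarith)
    have := Real.pi_pos
    exact (ENNReal.ofReal_pos.2 (by positivity)).ne'
  · intro g hg
    obtain ⟨x, hx, hgx⟩ := hg.pos
    -- The given point may be the origin, where `s` vanishes; continuity allows a move to some `a >
    -- x`.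
    have hc : Continuous fun a : ℝ => g (a • unitDiag n) :=
      hg.density.continuous.comp (by fun_prop)
    have h1 : ∀ᶠ a in 𝓝[>] x, 0 < g (a • unitDiag n) :=
      nhdsWithin_le_nhds ((hc.tendsto x).eventually_const_lt hgx)
    obtain ⟨a, ha, hxa⟩ := (h1.and self_mem_nhdsWithin).exists
    refine ⟨a, hx.trans_lt hxa, ?_⟩
    simpa [lineEquiv_apply] using ha
  · intro g hg
    obtain ⟨ε, hε, h⟩ := hg.integrable
    refine ⟨ε, hε, ne_top_of_le_ne_top h.ne (lintegral_mono fun a => ?_)⟩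
    rw [hd]
    gcongr
    refine iSup_comp_le_iSup (fun ξ => ⟨ξ.1, ξ.1.2, ξ.2⟩) fun ξ => ?_
    simp [lineEquiv_apply]
  · intro g hg
    rw [oneSampleK, hd]
    simp [lineEquiv_apply]
    rfl

/-! ### The `F`-statistic -/

/-- Only the part of `Y` orthogonal to the diagonal is transverse, so `a = (x, r)` and `d = n₂ - 1`.
The statistic is the square of `sampleSD x / sampleSD η`, whence `ψ = √`. -/
theorem tailComparison_F {n₁ n₂ : ℕ} (hn₁ : 2 ≤ n₁) (hn₂ : 2 ≤ n₂) :
    TailComparison (fStat n₁ n₂) (FRegular n₁ n₂) (fK n₁ n₂) := by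
  have hn0 : n₂ ≠ 0 := by omega
  have hn₁R : (2 : ℝ) ≤ n₁ := by exact_mod_cast hn₁
  have hnR : (2 : ℝ) ≤ n₂ := by exact_mod_cast hn₂
  have := nontrivial_orthogonal_unitDiag hn₂
  have hd := finrank_orthogonal_unitDiag hn0
  have hsd : Continuous fun x : Euc (Fin n₁) => sampleSD x :=
    continuous_sampleSD.comp (by fun_prop)
  let L : ((Euc (Fin n₁) × ℝ) × (Submodule.span ℝ {unitDiag n₂})ᗮ) ≃L[ℝ]
      (Euc (Fin n₁) × Euc (Fin n₂)) :=
    (ContinuousLinearEquiv.prodAssoc ℝ _ _ _).trans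
      ((ContinuousLinearEquiv.refl ℝ _).prodCongr (lineEquiv _ (unitDiag_ne_zero hn0)))
  have hL : ∀ x r η, L ((x, r), η) = (x, r • unitDiag n₂ + (η : Euc (Fin n₂))) := by
    intro x r η
    rw [← lineEquiv_apply _ (unitDiag_ne_zero hn0)]
    rfl
  -- The restriction to `s > 0` is harmless: the exponent `n₂ - 1` is at least one, so the weight
  -- vanishes where `sampleSD` does.
  have hset : ∀ f : Euc (Fin n₁) × ℝ → ℝ≥0∞,
      ∫⁻ a in {a : Euc (Fin n₁) × ℝ | 0 < sampleSD a.1},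
        ENNReal.ofReal (sampleSD a.1 ^ (n₂ - 1)) * f a
      = ∫⁻ a : Euc (Fin n₁) × ℝ, ENNReal.ofReal (sampleSD a.1 ^ (n₂ - 1)) * f a := by
    intro f
    refine setLIntegral_eq_of_support_subset ?_
    intro a ha
    refine (Real.sqrt_nonneg _).lt_of_ne fun h0 => ha ?_
    have : sampleSD a.1 = 0 := h0.symm
    simp [this, show n₂ - 1 ≠ 0 by omega]
  have : (volume : Measure (Euc (Fin n₁) × ℝ)).IsAddHaarMeasure := by
    rw [Measure.volume_eq_prod]
    infer_instance
  have : (volume : Measure (Euc (Fin n₁) × Euc (Fin n₂))).IsAddHaarMeasure := by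
    rw [Measure.volume_eq_prod]
    infer_instance
  refine tailComparison_of_ratio L (s := fun a => sampleSD a.1)
    (hsd.comp continuous_fst) (Q := fun η => sampleSD (η : Euc (Fin n₂))) ?_ ?_
    (κ := (Real.sqrt ((n₂ : ℝ) - 1))⁻¹) ?_ (sampleSD_line_ge hn₂) ?_
    (ψ := fun u => Real.sqrt u) Real.tendsto_sqrt_atTop ?_
    (C := ENNReal.ofReal
      (Real.Gamma (((n₁ : ℝ) - 1) / 2) * (Real.pi * ((n₁ : ℝ) - 1)) ^ (((n₂ : ℝ) - 1) / 2)
        / Real.Gamma (((n₁ : ℝ) + n₂ - 2) / 2)))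
    ?_ ENNReal.ofReal_ne_top (fun g hg => hg.density) ?_ ?_ ?_
  · exact continuous_sampleSD.comp (by fun_prop)
  · intro t η ht
    exact sampleSD_smul ht _
  · exact inv_pos.2 (Real.sqrt_pos.2 (by linarith))
  · exact (continuous_sampleVar.comp (by fun_prop)).measurable.div
      (continuous_sampleVar.comp (by fun_prop)).measurable
  · filter_upwards [eventually_ge_atTop 0] with u hu a η
    obtain ⟨x, r⟩ := a
    rw [hL, fStat]
    simp only
    rw [sampleVar_line hn₂, sampleSD, sampleSD, ← Real.sqrt_div (sampleVar_nonneg hn₁ _),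
      Real.sqrt_lt_sqrt_iff hu]
  · have h1 : 0 < Real.Gamma (((n₁ : ℝ) - 1) / 2) := Real.Gamma_pos_of_pos (by linarith)
    have h2 : 0 < Real.Gamma (((n₁ : ℝ) + n₂ - 2) / 2) := Real.Gamma_pos_of_pos (by linarith)
    have h3 : 0 < Real.pi * ((n₁ : ℝ) - 1) := mul_pos Real.pi_pos (by linarith)
    exact (ENNReal.ofReal_pos.2 (by positivity)).ne'
  · intro g hg
    obtain ⟨x, r, h⟩ := hg.pos
    have hs : 0 < sampleSD x := (Real.sqrt_nonneg _).lt_of_ne fun h0 => by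
      have : sampleSD x = 0 := h0.symm
      simp [this] at h
    refine ⟨(x, r), hs, ?_⟩
    simpa [hL] using pos_of_mul_pos_right h hs.le
  · intro g hg
    obtain ⟨ε, hε, h⟩ := hg.integrable
    refine ⟨ε, hε, ne_top_of_le_ne_top h.ne ?_⟩
    rw [hd, hset]
    refine (lintegral_prod_le _).trans (lintegral_mono fun x => ?_)
    simp only
    rw [lintegral_const_mul' _ _ ENNReal.ofReal_ne_top]
    gcongr with r
    refine iSup_comp_le_iSup (fun ξ => ⟨ξ.1, ξ.1.2, ξ.2⟩) fun ξ => ?_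
    simp [hL]
  · intro g hg
    have hgc := hg.density.continuous
    rw [fK, hd, hset, Measure.volume_eq_prod, lintegral_prod]
    · simp only [hL, Submodule.coe_zero, add_zero]
      congr 1
      refine lintegral_congr fun x => ?_
      rw [lintegral_const_mul' _ _ ENNReal.ofReal_ne_top]
    · have h1 : Continuous fun a : Euc (Fin n₁) × ℝ => sampleSD a.1 ^ (n₂ - 1) :=
        (hsd.comp continuous_fst).pow _
      have h2 : Continuous fun a : Euc (Fin n₁) × ℝ => g (L (a, 0)) := by fun_prop
      exact (h1.measurable.ennreal_ofReal.mul h2.measurable.ennreal_ofReal).aemeasurable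

/-! ### Plane coordinates and polar integration -/

/-- Coordinates along and orthogonal to a plane `K` with orthonormal basis `e₁, e₂`. -/
def planeEquiv {E : Type} [NormedAddCommGroup E] [InnerProductSpace ℝ E] [FiniteDimensional ℝ E]
    (K : Submodule ℝ E) (e₁ e₂ : E) (h₁ : e₁ ∈ K) (h₂ : e₂ ∈ K)
    (h₁₁ : inner ℝ e₁ e₁ = (1 : ℝ)) (h₂₂ : inner ℝ e₂ e₂ = (1 : ℝ))
    (h₁₂ : inner ℝ e₁ e₂ = (0 : ℝ))
    (hK : ∀ x, inner ℝ e₁ x = (0 : ℝ) → inner ℝ e₂ x = (0 : ℝ) → x ∈ Kᗮ) :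
    ((ℝ × ℝ) × Kᗮ) ≃L[ℝ] E :=
  LinearEquiv.toContinuousLinearEquiv
    { toFun := fun p => p.1.1 • e₁ + p.1.2 • e₂ + (p.2 : E)
      map_add' := fun p q => by
        simp only [Prod.fst_add, Prod.snd_add, Submodule.coe_add]
        module
      map_smul' := fun t p => by
        simp only [Prod.smul_fst, Prod.smul_snd, Submodule.coe_smul, RingHom.id_apply, smul_eq_mul]
        module
      invFun := fun x => ((inner ℝ e₁ x, inner ℝ e₂ x),
        ⟨x - (inner ℝ e₁ x : ℝ) • e₁ - (inner ℝ e₂ x : ℝ) • e₂, hK _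
          (by simp [inner_sub_right, inner_smul_right, -inner_self_eq_norm_sq_to_K, h₁₁, h₁₂])
          (by simp [inner_sub_right, inner_smul_right, -inner_self_eq_norm_sq_to_K, h₂₂,
            real_inner_comm e₁ e₂, h₁₂])⟩)
      left_inv := fun p => by
        have i₁ : inner ℝ e₁ (p.2 : E) = (0 : ℝ) := p.2.2 _ h₁
        have i₂ : inner ℝ e₂ (p.2 : E) = (0 : ℝ) := p.2.2 _ h₂
        have j₁ : inner ℝ e₁ (p.1.1 • e₁ + p.1.2 • e₂ + (p.2 : E)) = p.1.1 := by
          simp [inner_add_right, inner_smul_right, -inner_self_eq_norm_sq_to_K, h₁₁, h₁₂, i₁]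
        have j₂ : inner ℝ e₂ (p.1.1 • e₁ + p.1.2 • e₂ + (p.2 : E)) = p.1.2 := by
          simp [inner_add_right, inner_smul_right, -inner_self_eq_norm_sq_to_K, h₂₂,
            real_inner_comm e₁ e₂, h₁₂, i₂]
        refine Prod.ext (Prod.ext j₁ j₂) (Subtype.ext ?_)
        simp only [j₁, j₂]
        abel
      right_inv := fun x => by
        simp only
        abel }

/-- Integration over the right half-plane in polar coordinates. -/
theorem lintegral_halfPlane {f : ℝ × ℝ → ℝ≥0∞} (hf : Measurable f) :
    ∫⁻ y in {y : ℝ × ℝ | 0 < y.1}, f y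
      = ∫⁻ ω in Set.Icc (-(Real.pi / 2)) (Real.pi / 2), ∫⁻ r in Set.Ioi (0 : ℝ),
          ENNReal.ofReal r * f (r * Real.cos ω, r * Real.sin ω) := by
  have hS : MeasurableSet {y : ℝ × ℝ | 0 < y.1} := measurableSet_lt measurable_const measurable_fst
  have hpi := Real.pi_pos
  have hsub : Set.Ioi (0 : ℝ) ×ˢ Set.Ioo (-(Real.pi / 2)) (Real.pi / 2) ⊆ polarCoord.target := by
    rintro ⟨r, ω⟩ ⟨h1, h2, h3⟩
    exact ⟨h1, by simp only at h2 ⊢; linarith, by simp only at h3 ⊢; linarith⟩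
  have hm : Measurable fun p : ℝ × ℝ =>
      ENNReal.ofReal p.1 * f (p.1 * Real.cos p.2, p.1 * Real.sin p.2) := by fun_prop
  -- The angles of `polarCoord` fill `(-π, π)`; the half-plane cuts out `cos ω > 0`, that is `|ω| <
  -- π / 2`, and the endpoints of `Icc` are null.
  rw [← lintegral_indicator hS, ← lintegral_comp_polarCoord_symm,
    setLIntegral_congr (Ioo_ae_eq_Icc (a := -(Real.pi / 2)) (b := Real.pi / 2)).symm,
    ← setLIntegral_prod_symm (f := fun p : ℝ × ℝ =>
      ENNReal.ofReal p.1 * f (p.1 * Real.cos p.2, p.1 * Real.sin p.2)) hm.aemeasurable,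
    ← Measure.volume_eq_prod, ← lintegral_indicator (measurableSet_Ioi.prod measurableSet_Ioo),
    ← lintegral_indicator polarCoord.open_target.measurableSet]
  refine lintegral_congr fun p => ?_
  by_cases hp : p ∈ Set.Ioi (0 : ℝ) ×ˢ Set.Ioo (-(Real.pi / 2)) (Real.pi / 2)
  · have hc : 0 < p.1 * Real.cos p.2 := mul_pos hp.1 (Real.cos_pos_of_mem_Ioo hp.2)
    rw [Set.indicator_of_mem hp, Set.indicator_of_mem (hsub hp), Set.indicator_of_mem (by exact hc)]
    rfl
  · rw [Set.indicator_of_notMem hp]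
    by_cases ht : p ∈ polarCoord.target
    · have hc : ¬ 0 < p.1 * Real.cos p.2 := by
        intro hc
        obtain ⟨h0, h1, h2⟩ := ht
        have hcos : 0 < Real.cos p.2 := pos_of_mul_pos_right hc (le_of_lt h0)
        refine hp ⟨h0, ?_, ?_⟩
        · by_contra hlt
          have := Real.cos_nonpos_of_pi_div_two_le_of_le (x := -p.2) (by linarith) (by linarith)
          rw [Real.cos_neg] at this
          linarith
        · by_contra hlt
          have := Real.cos_nonpos_of_pi_div_two_le_of_le (x := p.2) (by linarith) (by linarith)
          linarith
      rw [Set.indicator_of_mem ht, Set.indicator_of_notMem (by exact hc), smul_zero]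
    · rw [Set.indicator_of_notMem ht]

theorem planeDir_eq (n₁ n₂ : ℕ) (ω : ℝ) : planeDir n₁ n₂ ω
    = Real.cos ω • planeDir n₁ n₂ 0 + Real.sin ω • planeDir n₁ n₂ (Real.pi / 2) := by
  simp only [planeDir, zero_sub, Real.cos_neg, Real.sin_neg, Real.cos_sub, Real.sin_sub,
    Real.cos_pi_div_two, Real.sin_pi_div_two]
  module

theorem inner_unitFst (n₁ n₂ : ℕ) (x : Euc (Fin n₁ ⊕ Fin n₂)) :
    inner ℝ (unitFst n₁ n₂) x = (∑ i, x (Sum.inl i)) / Real.sqrt n₁ := by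
  simp [unitFst, PiLp.inner_apply, Finset.sum_mul, div_eq_mul_inv]

theorem inner_unitSnd (n₁ n₂ : ℕ) (x : Euc (Fin n₁ ⊕ Fin n₂)) :
    inner ℝ (unitSnd n₁ n₂) x = (∑ i, x (Sum.inr i)) / Real.sqrt n₂ := by
  simp [unitSnd, PiLp.inner_apply, Finset.sum_mul, div_eq_mul_inv]

theorem inner_unitFst_self {n₁ n₂ : ℕ} (h : n₁ ≠ 0) :
    inner ℝ (unitFst n₁ n₂) (unitFst n₁ n₂) = (1 : ℝ) := by
  have : (n₁ : ℝ) ≠ 0 := by exact_mod_cast h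
  rw [inner_unitFst]
  simp [unitFst]
  rw [mul_div_assoc, inv_div_left, Real.mul_self_sqrt (by positivity), mul_inv_cancel₀ this]

theorem inner_unitSnd_self {n₁ n₂ : ℕ} (h : n₂ ≠ 0) :
    inner ℝ (unitSnd n₁ n₂) (unitSnd n₁ n₂) = (1 : ℝ) := by
  have : (n₂ : ℝ) ≠ 0 := by exact_mod_cast h
  rw [inner_unitSnd]
  simp [unitSnd]
  rw [mul_div_assoc, inv_div_left, Real.mul_self_sqrt (by positivity), mul_inv_cancel₀ this]

theorem inner_unitFst_unitSnd (n₁ n₂ : ℕ) :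
    inner ℝ (unitFst n₁ n₂) (unitSnd n₁ n₂) = (0 : ℝ) := by
  rw [inner_unitFst]
  simp [unitSnd]

theorem inner_planeDir {n₁ n₂ : ℕ} (h₁ : n₁ ≠ 0) (h₂ : n₂ ≠ 0) (ω ω' : ℝ) :
    inner ℝ (planeDir n₁ n₂ ω) (planeDir n₁ n₂ ω') = Real.cos (ω - ω') := by
  have h21 : inner ℝ (unitSnd n₁ n₂) (unitFst n₁ n₂) = (0 : ℝ) := by
    rw [real_inner_comm, inner_unitFst_unitSnd]
  simp only [planeDir, inner_add_left, inner_add_right, inner_smul_left, inner_smul_right,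
    inner_unitFst_self h₁, inner_unitSnd_self h₂, inner_unitFst_unitSnd, h21]
  rw [show ω - ω' = (ω - omegaZero n₁ n₂) - (ω' - omegaZero n₁ n₂) by ring,
    Real.cos_sub (ω - omegaZero n₁ n₂)]
  simp
  ring

theorem planeDir_mem (n₁ n₂ : ℕ) (ω : ℝ) :
    planeDir n₁ n₂ ω ∈ Submodule.span ℝ {unitFst n₁ n₂, unitSnd n₁ n₂} :=
  Submodule.mem_span_pair.2 ⟨_, _, rfl⟩

theorem unitFst_eq (n₁ n₂ : ℕ) : unitFst n₁ n₂ = Real.cos (omegaZero n₁ n₂) • planeDir n₁ n₂ 0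
    + Real.sin (omegaZero n₁ n₂) • planeDir n₁ n₂ (Real.pi / 2) := by
  rw [← planeDir_eq]
  simp [planeDir]

theorem unitSnd_eq (n₁ n₂ : ℕ) : unitSnd n₁ n₂ = -Real.sin (omegaZero n₁ n₂) • planeDir n₁ n₂ 0
    + Real.cos (omegaZero n₁ n₂) • planeDir n₁ n₂ (Real.pi / 2) := by
  have h := planeDir_eq n₁ n₂ (omegaZero n₁ n₂ + Real.pi / 2)
  rw [Real.cos_add_pi_div_two, Real.sin_add_pi_div_two] at h
  rw [← h]
  simp [planeDir]

theorem mem_orthogonal_of_inner_planeDir {n₁ n₂ : ℕ} (x : Euc (Fin n₁ ⊕ Fin n₂))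
    (h₁ : inner ℝ (planeDir n₁ n₂ 0) x = (0 : ℝ))
    (h₂ : inner ℝ (planeDir n₁ n₂ (Real.pi / 2)) x = (0 : ℝ)) :
    x ∈ (Submodule.span ℝ {unitFst n₁ n₂, unitSnd n₁ n₂})ᗮ := by
  rw [Submodule.mem_orthogonal]
  intro y hy
  obtain ⟨a, b, rfl⟩ := Submodule.mem_span_pair.1 hy
  rw [unitFst_eq, unitSnd_eq]
  simp only [inner_add_left, inner_smul_left, h₁, h₂, mul_zero, add_zero]

theorem sum_fst_eq_zero {n₁ n₂ : ℕ} (h : n₁ ≠ 0) {η : Euc (Fin n₁ ⊕ Fin n₂)}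
    (hη : η ∈ (Submodule.span ℝ {unitFst n₁ n₂, unitSnd n₁ n₂})ᗮ) :
    ∑ i, fstSample η i = 0 := by
  have h1 := hη _ (Submodule.subset_span (Set.mem_insert _ _))
  have h2 : (0 : ℝ) < n₁ := by exact_mod_cast Nat.pos_of_ne_zero h
  rw [inner_unitFst] at h1
  exact (div_eq_zero_iff.1 h1).resolve_right (Real.sqrt_pos.2 h2).ne'

theorem sum_snd_eq_zero {n₁ n₂ : ℕ} (h : n₂ ≠ 0) {η : Euc (Fin n₁ ⊕ Fin n₂)}
    (hη : η ∈ (Submodule.span ℝ {unitFst n₁ n₂, unitSnd n₁ n₂})ᗮ) :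
    ∑ i, sndSample η i = 0 := by
  have h1 := hη _ (Submodule.subset_span (Set.mem_insert_of_mem _ rfl))
  have h2 : (0 : ℝ) < n₂ := by exact_mod_cast Nat.pos_of_ne_zero h
  rw [inner_unitSnd] at h1
  exact (div_eq_zero_iff.1 h1).resolve_right (Real.sqrt_pos.2 h2).ne'

theorem cos_omegaZero (n₁ n₂ : ℕ) :
    Real.cos (omegaZero n₁ n₂) = Real.sqrt ((n₂ : ℝ) / ((n₁ : ℝ) + n₂)) := by
  rw [omegaZero, Real.cos_arccos]
  · linarith [Real.sqrt_nonneg ((n₂ : ℝ) / ((n₁ : ℝ) + n₂))]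
  · rw [Real.sqrt_le_one]
    exact div_le_one_of_le₀ (by linarith [Nat.cast_nonneg (α := ℝ) n₁]) (by positivity)

theorem sin_omegaZero {n₁ n₂ : ℕ} (h : n₁ ≠ 0) :
    Real.sin (omegaZero n₁ n₂) = Real.sqrt ((n₁ : ℝ) / ((n₁ : ℝ) + n₂)) := by
  have h2 : (0 : ℝ) < n₁ := by exact_mod_cast Nat.pos_of_ne_zero h
  rw [omegaZero, Real.sin_arccos, Real.sq_sqrt (by positivity)]
  congr 1
  field_simp
  ring

/-! ### The two-sample `t`-statistics -/

/-- The denominator of the two-sample statistic. -/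
def pooledSD (n₁ n₂ : ℕ) (α β : ℝ) (x : Euc (Fin n₁ ⊕ Fin n₂)) : ℝ :=
  Real.sqrt (α * sampleVar (fstSample x) + β * sampleVar (sndSample x))

theorem continuous_pooledSD (n₁ n₂ : ℕ) (α β : ℝ) : Continuous (pooledSD n₁ n₂ α β) := by
  have h1 : Continuous fun x : Euc (Fin n₁ ⊕ Fin n₂) => sampleVar (fstSample x) :=
    continuous_sampleVar.comp (by unfold fstSample; fun_prop)
  have h2 : Continuous fun x : Euc (Fin n₁ ⊕ Fin n₂) => sampleVar (sndSample x) :=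
    continuous_sampleVar.comp (by unfold sndSample; fun_prop)
  unfold pooledSD
  fun_prop

theorem pooledSD_smul (n₁ n₂ : ℕ) (α β : ℝ) {t : ℝ} (ht : 0 < t) (x : Euc (Fin n₁ ⊕ Fin n₂)) :
    pooledSD n₁ n₂ α β (t • x) = t * pooledSD n₁ n₂ α β x := by
  have h1 : fstSample (t • x) = t • fstSample x := rfl
  have h2 : sndSample (t • x) = t • sndSample x := rfl
  rw [pooledSD, h1, h2, sampleVar_smul, sampleVar_smul, pooledSD,
    show α * (t ^ 2 * sampleVar (fstSample x)) + β * (t ^ 2 * sampleVar (sndSample x))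
      = t ^ 2 * (α * sampleVar (fstSample x) + β * sampleVar (sndSample x)) by ring,
    Real.sqrt_mul (sq_nonneg t), Real.sqrt_sq ht.le]

theorem le_pooledSD {n₁ n₂ : ℕ} (h₁ : 2 ≤ n₁) (h₂ : 2 ≤ n₂) {α β : ℝ}
    {η : Euc (Fin n₁ ⊕ Fin n₂)}
    (hη : η ∈ (Submodule.span ℝ {unitFst n₁ n₂, unitSnd n₁ n₂})ᗮ) :
    Real.sqrt (min (α / ((n₁ : ℝ) - 1)) (β / ((n₂ : ℝ) - 1))) * ‖η‖ ≤ pooledSD n₁ n₂ α β η := by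
  have e1 := sampleVar_const_add (by omega) 0 (sum_fst_eq_zero (by omega) hη)
  have e2 := sampleVar_const_add (by omega) 0 (sum_snd_eq_zero (by omega) hη)
  simp only [zero_add] at e1 e2
  have e1' : sampleVar (fstSample η) = (∑ i, fstSample η i ^ 2) / ((n₁ : ℝ) - 1) := e1
  have e2' : sampleVar (sndSample η) = (∑ i, sndSample η i ^ 2) / ((n₂ : ℝ) - 1) := e2
  rw [pooledSD, e1', e2', EuclideanSpace.norm_eq, ← Real.sqrt_mul' _ (by positivity)]
  refine Real.sqrt_le_sqrt ?_
  simp only [Real.norm_eq_abs, sq_abs, Fintype.sum_sum_type]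
  have f1 : 0 ≤ ∑ i, fstSample η i ^ 2 := by positivity
  have f2 : 0 ≤ ∑ i, sndSample η i ^ 2 := by positivity
  have g1 := mul_le_mul_of_nonneg_right
    (min_le_left (α / ((n₁ : ℝ) - 1)) (β / ((n₂ : ℝ) - 1))) f1
  have g2 := mul_le_mul_of_nonneg_right
    (min_le_right (α / ((n₁ : ℝ) - 1)) (β / ((n₂ : ℝ) - 1))) f2
  calc _ = min (α / ((n₁ : ℝ) - 1)) (β / ((n₂ : ℝ) - 1)) * ∑ i, fstSample η i ^ 2
        + min (α / ((n₁ : ℝ) - 1)) (β / ((n₂ : ℝ) - 1)) * ∑ i, sndSample η i ^ 2 := by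
        rw [← mul_add]; rfl
    _ ≤ _ := add_le_add g1 g2
    _ = _ := by ring

/-- The slope of `sampleMean (fstSample x) - sampleMean (sndSample x)` along `planeDir n₁ n₂ 0`. -/
def meanDiffSlope (n₁ n₂ : ℕ) : ℝ :=
  Real.cos (omegaZero n₁ n₂) / Real.sqrt n₁ + Real.sin (omegaZero n₁ n₂) / Real.sqrt n₂

theorem meanDiffSlope_pos {n₁ n₂ : ℕ} (h₁ : n₁ ≠ 0) (h₂ : n₂ ≠ 0) : 0 < meanDiffSlope n₁ n₂ := by
  have k1 : (0 : ℝ) < n₁ := by exact_mod_cast Nat.pos_of_ne_zero h₁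
  have k2 : (0 : ℝ) < n₂ := by exact_mod_cast Nat.pos_of_ne_zero h₂
  rw [meanDiffSlope, cos_omegaZero, sin_omegaZero h₁]
  positivity

/-- The angle `omegaZero` is chosen so that `planeDir (π / 2)` is the diagonal of the whole space.
Moving along it shifts both sample means equally, so `y.2` drops out and only `y.1` drives their
difference. -/
theorem twoSampleT_plane {n₁ n₂ : ℕ} (h₁ : n₁ ≠ 0) (h₂ : n₂ ≠ 0) (α β : ℝ) (y : ℝ × ℝ)
    {η : Euc (Fin n₁ ⊕ Fin n₂)}
    (hη : η ∈ (Submodule.span ℝ {unitFst n₁ n₂, unitSnd n₁ n₂})ᗮ) :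
    twoSampleT n₁ n₂ α β (y.1 • planeDir n₁ n₂ 0 + y.2 • planeDir n₁ n₂ (Real.pi / 2) + η)
      = meanDiffSlope n₁ n₂ * (y.1 / pooledSD n₁ n₂ α β η) := by
  have k1 : (0 : ℝ) < n₁ := by exact_mod_cast Nat.pos_of_ne_zero h₁
  have k2 : (0 : ℝ) < n₂ := by exact_mod_cast Nat.pos_of_ne_zero h₂
  set x := y.1 • planeDir n₁ n₂ 0 + y.2 • planeDir n₁ n₂ (Real.pi / 2) + η with hx
  set c := Real.cos (omegaZero n₁ n₂) with hc
  set s := Real.sin (omegaZero n₁ n₂) with hs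
  have hf : fstSample x = fun i => (y.1 * c + y.2 * s) / Real.sqrt n₁ + fstSample η i := by
    ext i
    simp [hx, fstSample, planeDir, unitFst, unitSnd, Real.cos_pi_div_two_sub,
      Real.sin_pi_div_two_sub, ← hc, ← hs]
    ring
  have hg : sndSample x = fun i => (-y.1 * s + y.2 * c) / Real.sqrt n₂ + sndSample η i := by
    ext i
    simp [hx, sndSample, planeDir, unitFst, unitSnd, Real.cos_pi_div_two_sub,
      Real.sin_pi_div_two_sub, ← hc, ← hs]
    ring
  have e1 := sum_fst_eq_zero h₁ hη
  have e2 := sum_snd_eq_zero h₂ hη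
  have hf0 : fstSample η = fun i => 0 + fstSample η i := by simp
  have hg0 : sndSample η = fun i => 0 + sndSample η i := by simp
  have hv1 : sampleVar (fstSample x) = sampleVar (fstSample η) := by
    rw [hf, sampleVar_const_add h₁ _ e1, hf0, sampleVar_const_add h₁ _ e1]
    simp
  have hv2 : sampleVar (sndSample x) = sampleVar (sndSample η) := by
    rw [hg, sampleVar_const_add h₂ _ e2, hg0, sampleVar_const_add h₂ _ e2]
    simp
  rw [twoSampleT, hv1, hv2, ← pooledSD, hf, hg, sampleMean_const_add h₁ _ e1,
    sampleMean_const_add h₂ _ e2, ← mul_div_assoc]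
  congr 1
  have hz : s / Real.sqrt n₁ = c / Real.sqrt n₂ := by
    rw [hs, hc, cos_omegaZero, sin_omegaZero h₁, Real.sqrt_div k1.le, Real.sqrt_div k2.le]
    have := Real.sqrt_pos.2 k1
    have := Real.sqrt_pos.2 k2
    field_simp
  rw [meanDiffSlope, ← hc, ← hs]
  linear_combination y.2 * hz

theorem twoSampleC_pos {n₁ n₂ : ℕ} (h₁ : 2 ≤ n₁) (h₂ : 2 ≤ n₂) {α β : ℝ} (hα : 0 < α)
    (hβ : 0 < β) : 0 < twoSampleC n₁ n₂ α β := by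
  have k1 : (2 : ℝ) ≤ n₁ := by exact_mod_cast h₁
  have k2 : (2 : ℝ) ≤ n₂ := by exact_mod_cast h₂
  have l1 : (0 : ℝ) < (n₁ : ℝ) - 1 := by linarith
  have l2 : (0 : ℝ) < (n₂ : ℝ) - 1 := by linarith
  have l3 : (0 : ℝ) < (n₁ : ℝ) + n₂ - 2 := by linarith
  have l4 : 0 < Real.Gamma (((n₁ : ℝ) + n₂ - 1) / 2) := Real.Gamma_pos_of_pos (by linarith)
  have l5 : (0 : ℝ) < n₁ := by linarith
  have l6 := Real.pi_pos
  unfold twoSampleC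
  positivity

theorem tailComparison_twoSample {n₁ n₂ : ℕ} (h₁ : 2 ≤ n₁) (h₂ : 2 ≤ n₂) {α β : ℝ} (hα : 0 < α)
    (hβ : 0 < β) : TailComparison (twoSampleT n₁ n₂ α β) (TwoSampleRegular n₁ n₂)
      (twoSampleK n₁ n₂ α β) := by
  have hn₁ : n₁ ≠ 0 := by omega
  have hn₂ : n₂ ≠ 0 := by omega
  have k1 : (2 : ℝ) ≤ n₁ := by exact_mod_cast h₁
  have k2 : (2 : ℝ) ≤ n₂ := by exact_mod_cast h₂
  let L := planeEquiv (Submodule.span ℝ {unitFst n₁ n₂, unitSnd n₁ n₂}) (planeDir n₁ n₂ 0)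
    (planeDir n₁ n₂ (Real.pi / 2)) (planeDir_mem _ _ _) (planeDir_mem _ _ _)
    (by rw [inner_planeDir hn₁ hn₂]; simp) (by rw [inner_planeDir hn₁ hn₂]; simp)
    (by rw [inner_planeDir hn₁ hn₂]; simp) mem_orthogonal_of_inner_planeDir
  have hL : ∀ y η, L (y, η) = y.1 • planeDir n₁ n₂ 0 + y.2 • planeDir n₁ n₂ (Real.pi / 2)
      + (η : Euc (Fin n₁ ⊕ Fin n₂)) := fun y η => rfl
  have hLpolar : ∀ r ω η, L ((r * Real.cos ω, r * Real.sin ω), η)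
      = r • planeDir n₁ n₂ ω + (η : Euc (Fin n₁ ⊕ Fin n₂)) := by
    intro r ω η
    rw [hL, planeDir_eq n₁ n₂ ω]
    module
  have hd : Module.finrank ℝ (Submodule.span ℝ {unitFst n₁ n₂, unitSnd n₁ n₂})ᗮ = n₁ + n₂ - 2 := by
    have h := L.toLinearEquiv.finrank_eq
    simp at h
    omega
  have : Nontrivial (Submodule.span ℝ {unitFst n₁ n₂, unitSnd n₁ n₂})ᗮ :=
    Module.nontrivial_of_finrank_pos (R := ℝ) (by omega)
  have : (volume : Measure (ℝ × ℝ)).IsAddHaarMeasure := by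
    rw [Measure.volume_eq_prod]
    infer_instance
  have hslope := meanDiffSlope_pos hn₁ hn₂
  have hpolar : ∀ f : ℝ × ℝ → ℝ≥0∞, Measurable f →
      ∫⁻ y in {y : ℝ × ℝ | 0 < y.1}, ENNReal.ofReal (y.1 ^ (n₁ + n₂ - 2)) * f y
      = ∫⁻ ω in Set.Icc (-(Real.pi / 2)) (Real.pi / 2),
        ENNReal.ofReal (Real.cos ω ^ (n₁ + n₂ - 2)) *
        ∫⁻ r in Set.Ioi (0 : ℝ), ENNReal.ofReal (r ^ (n₁ + n₂ - 1)) *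
          f (r * Real.cos ω, r * Real.sin ω) := by
    intro f hf
    rw [lintegral_halfPlane (by fun_prop)]
    refine setLIntegral_congr_fun measurableSet_Icc fun ω hω => ?_
    rw [← lintegral_const_mul' _ _ ENNReal.ofReal_ne_top]
    refine setLIntegral_congr_fun measurableSet_Ioi fun r (hr : 0 < r) => ?_
    have hcos : 0 ≤ Real.cos ω := Real.cos_nonneg_of_mem_Icc hω
    simp only
    -- The Jacobian `r` times the weight `(r cos ω) ^ (n - 2)` is `cos ω ^ (n - 2) * r ^ (n - 1)`.
    rw [← mul_assoc, ← mul_assoc, ← ENNReal.ofReal_mul hr.le, ← ENNReal.ofReal_mul (by positivity),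
      mul_pow, show n₁ + n₂ - 1 = (n₁ + n₂ - 2) + 1 by omega, pow_succ]
    congr 2
    ring
  refine tailComparison_of_ratio L (s := fun y => y.1) continuous_fst
    (Q := fun η => pooledSD n₁ n₂ α β η) ?_ ?_
    (κ := Real.sqrt (min (α / ((n₁ : ℝ) - 1)) (β / ((n₂ : ℝ) - 1)))) ?_
    (fun η => le_pooledSD h₁ h₂ η.2) ?_ (ψ := fun u => u / meanDiffSlope n₁ n₂)
    (tendsto_id.atTop_div_const hslope) ?_ (C := ENNReal.ofReal (twoSampleC n₁ n₂ α β))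
    ?_ ENNReal.ofReal_ne_top (fun g hg => hg.density) ?_ ?_ ?_
  · exact (continuous_pooledSD _ _ _ _).comp (by fun_prop)
  · intro t η ht
    exact pooledSD_smul _ _ _ _ ht _
  · exact Real.sqrt_pos.2 (lt_min (div_pos hα (by linarith)) (div_pos hβ (by linarith)))
  · have m1 : Continuous fun x : Euc (Fin n₁ ⊕ Fin n₂) => sampleMean (fstSample x) :=
      continuous_sampleMean.comp (by unfold fstSample; fun_prop)
    have m2 : Continuous fun x : Euc (Fin n₁ ⊕ Fin n₂) => sampleMean (sndSample x) :=
      continuous_sampleMean.comp (by unfold sndSample; fun_prop)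
    exact (m1.sub m2).measurable.div (continuous_pooledSD n₁ n₂ α β).measurable
  · refine Eventually.of_forall fun u y η => ?_
    rw [hL, twoSampleT_plane hn₁ hn₂ _ _ _ η.2, div_lt_iff₀' hslope]
  · exact (ENNReal.ofReal_pos.2 (twoSampleC_pos h₁ h₂ hα hβ)).ne'
  · intro g hg
    obtain ⟨r, hr, ω, hω, hgr⟩ := hg.pos
    have hgc := hg.density.continuous
    -- The given point may lie on the boundary `y.1 = 0`, so the first coordinate is increased
    -- slightly.
    have hc : Continuous fun t : ℝ => g (L ((t, r * Real.sin ω), 0)) := by fun_prop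
    have h0 : 0 < g (L ((r * Real.cos ω, r * Real.sin ω), 0)) := by
      simpa [hLpolar] using hgr
    have h1 : ∀ᶠ t in 𝓝[>] (r * Real.cos ω), 0 < g (L ((t, r * Real.sin ω), 0)) :=
      nhdsWithin_le_nhds ((hc.tendsto _).eventually_const_lt h0)
    obtain ⟨t, ht, hlt⟩ := (h1.and self_mem_nhdsWithin).exists
    exact ⟨(t, r * Real.sin ω),
      (mul_nonneg hr (Real.cos_nonneg_of_mem_Icc hω)).trans_lt hlt, ht⟩
  · intro g hg
    have hgc := hg.density.continuous
    obtain ⟨ε, hε, h⟩ := hg.integrable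
    refine ⟨ε, hε, ne_top_of_le_ne_top h.ne ?_⟩
    rw [hd, hpolar]
    · refine setLIntegral_mono' measurableSet_Icc fun ω hω => ?_
      gcongr with r
      -- The tube has width proportional to `y.1 = r cos ω`, whereas condition (b) scales by `r`;
      -- the factor `cos ω` goes into `ξ` and does not increase its norm.
      refine iSup_comp_le_iSup (fun ξ => ⟨Real.cos ω • (ξ.1 : Euc (Fin n₁ ⊕ Fin n₂)),
        Submodule.smul_mem _ _ ξ.1.2, ?_⟩) fun ξ => ?_
      · rw [norm_smul]
        refine lt_of_le_of_lt (mul_le_of_le_one_left (norm_nonneg _) (Real.abs_cos_le_one ω)) ξ.2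
      · rw [hLpolar, Submodule.coe_smul, mul_smul, smul_add]
    -- Passing to polar coordinates does need measurability of the supremum; a supremum of
    -- continuous functions is lower semicontinuous.
    · refine LowerSemicontinuous.measurable (lowerSemicontinuous_iSup fun ξ => ?_)
      refine Continuous.lowerSemicontinuous (ENNReal.continuous_ofReal.comp ?_)
      fun_prop
  · intro g hg
    have hgm := hg.density.continuous.measurable
    have hLm : Measurable L := L.continuous.measurable
    rw [twoSampleK, hd, hpolar _ (by fun_prop)]
    simp only [hLpolar, Submodule.coe_zero, add_zero]

/-! ### Student and Welch as choices of the weights -/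

theorem studentTwoSampleT_eq (n₁ n₂ : ℕ) : studentTwoSampleT n₁ n₂ = twoSampleT n₁ n₂
    (((n₁ : ℝ) - 1) / ((n₁ : ℝ) + n₂ - 2) * (1 / (n₁ : ℝ) + 1 / (n₂ : ℝ)))
    (((n₂ : ℝ) - 1) / ((n₁ : ℝ) + n₂ - 2) * (1 / (n₁ : ℝ) + 1 / (n₂ : ℝ))) := by
  ext x
  rw [studentTwoSampleT, twoSampleT]
  congr 2
  ring

theorem welchT_eq (n₁ n₂ : ℕ) :
    welchT n₁ n₂ = twoSampleT n₁ n₂ (1 / (n₁ : ℝ)) (1 / (n₂ : ℝ)) := by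
  ext x
  rw [welchT, twoSampleT]
  congr 2
  ring

end TestTails

end

theorem theorem1p1 :
    (∀ n : ℕ, 2 ≤ n →
      TestTails.TailComparison (TestTails.oneSampleT n) (TestTails.OneSampleRegular n)
        (TestTails.oneSampleK n)) ∧
    (∀ n₁ n₂ : ℕ, 2 ≤ n₁ → 2 ≤ n₂ →
      (∀ α β : ℝ, 0 < α → 0 < β →
        TestTails.TailComparison (TestTails.twoSampleT n₁ n₂ α β)
          (TestTails.TwoSampleRegular n₁ n₂) (TestTails.twoSampleK n₁ n₂ α β)) ∧
      TestTails.TailComparison (TestTails.studentTwoSampleT n₁ n₂)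
        (TestTails.TwoSampleRegular n₁ n₂)
        (TestTails.twoSampleK n₁ n₂
          (((n₁ : ℝ) - 1) / ((n₁ : ℝ) + n₂ - 2) * (1 / (n₁ : ℝ) + 1 / (n₂ : ℝ)))
          (((n₂ : ℝ) - 1) / ((n₁ : ℝ) + n₂ - 2) * (1 / (n₁ : ℝ) + 1 / (n₂ : ℝ)))) ∧
      TestTails.TailComparison (TestTails.welchT n₁ n₂)
        (TestTails.TwoSampleRegular n₁ n₂)
        (TestTails.twoSampleK n₁ n₂ (1 / (n₁ : ℝ)) (1 / (n₂ : ℝ)))) ∧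
    (∀ n₁ n₂ : ℕ, 2 ≤ n₁ → 2 ≤ n₂ →
      TestTails.TailComparison (TestTails.fStat n₁ n₂) (TestTails.FRegular n₁ n₂)
        (TestTails.fK n₁ n₂)) := by
  refine ⟨fun n hn => TestTails.tailComparison_oneSample hn, fun n₁ n₂ h₁ h₂ => ?_,
    fun n₁ n₂ h₁ h₂ => TestTails.tailComparison_F h₁ h₂⟩
  have k₁ : (2 : ℝ) ≤ n₁ := by exact_mod_cast h₁
  have k₂ : (2 : ℝ) ≤ n₂ := by exact_mod_cast h₂
  have l₁ : (0 : ℝ) < (n₁ : ℝ) - 1 := by linarith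
  have l₂ : (0 : ℝ) < (n₂ : ℝ) - 1 := by linarith
  have l₃ : (0 : ℝ) < (n₁ : ℝ) + n₂ - 2 := by linarith
  have p₁ : (0 : ℝ) < n₁ := by linarith
  have p₂ : (0 : ℝ) < n₂ := by linarith
  refine ⟨fun α β hα hβ => TestTails.tailComparison_twoSample h₁ h₂ hα hβ, ?_, ?_⟩
  · rw [TestTails.studentTwoSampleT_eq]
    exact TestTails.tailComparison_twoSample h₁ h₂ (by positivity) (by positivity)
  · rw [TestTails.welchT_eq]
    exact TestTails.tailComparison_twoSample h₁ h₂ (by positivity) (by positivity)
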